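/- Conventions. An $\omega$-word over a finite alphabet $A$ with a distinguished symbol $0$ is a map $k\mapsto a_k$ from $\mathbb Z$ to $A$ with $a_h=0$ for all sufficiently large $h$. A nondeterministic Büchi automaton accepts it if, for some $k$ with $a_h=0$ for all $h\ge k$, it has a run on $a_k a_{k-1}a_{k-2}\ldots$ which visits accepting states infinitely often. A set of $\omega$-words is $\omega$-regular if it is the set of all $\omega$-words accepted by some finite automaton of this kind. The convolution of a tuple of $\omega$-words is the $\omega$-word of tuples $k\mapsto(x_1(k),\ldots,x_n(k))$. An $\omega$-automatic representation of the reals is an $\omega$-regular set $R$ of $\omega$-words over a finite alphabet together with a surjection $\mathrm{val}:R\to\mathbb R$ for which equality of values is $\omega$-automatic; here a relation on $\mathbb R$ is $\omega$-automatic if the set of convolutions of all tuples from $R$ whose values satisfy the relation is $\omega$-regular, and a function is $\omega$-automatic if its graph is. Let $G$ be one of the following subrings of $\mathbb R$. (a) A ring obtained by the general method: there are an integer $b\ge 1$, a real $c$ some power $c^r$ ($r\ge1$) of which is an integer, a real $u>1$, and Laurent polynomials with integer coefficients $p_1,p_2,p_3=\sum_{k=-h+1}^{0}d_kx^k$ with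 $d_0=1$, $p_4=\sum_k e_kx^k$, with $p_1(u)=1/b$, $p_2(u)=c$, $p_3(u)=0$, $p_4(u)=0$, and an $\ell$ with $e_\ell>\sum_{k\ne\ell}|e_k|$, and real bounds $\hat c_0,\ldots,\hat c_{h-1}>3|e_\ell|$ (for instance all equal), such that algorithm $C$ below satisfies its termination condition; and $$G=\Big\{\sum_{k=-m}^{n}a_ku^k : m,n\in\mathbb N,\ a_k\in\mathbb Z,\ |a_k|<|e_\ell|\Big\}.$$ Algorithm $C$, for $p=\sum_{k=-m}^{n}a_kx^k$ ($m,n\in\mathbb N$) with $a_k\in\mathbb Z$, $|a_k|\le 3|e_\ell|$: let $k=n+h$; while $k>-m$ and $|a_{k-i}|\le\hat c_i$ for all $0\le i<h$, replace $p$ by $p-a_k\,x^k p_3$ (updating the coefficients $a_{k'}$) and then $k$ by $k-1$. Termination condition: whenever the algorithm stops at some $k>-m$ because $|a_{k-i}|>\hat c_i$ for some $0\le i<h$, then $$\Big|\sum_{i=0}^{h-1}a_{k-i}u^{k-i}\Big|>\frac{u^{k-h}}{1-u^{-1}}\cdot 3|e_\ell|.$$ (b) One of the concrete rings $\mathbb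 Z[1/b]$ and $\mathbb Z[1/b,\sqrt{b^2-1}]$ for an integer $b\ge2$, $\mathbb Z[1/2,\sqrt2]$, $\mathbb Z[\sqrt[3]{7}]$, and $\mathbb Z[1/2,\sqrt[3]{65}]$. Then there is an $\omega$-automatic representation of the reals in which addition, subtraction and the comparisons $=,<,\le$ are $\omega$-automatic and in which, for every $g\in G$, the unary function $x\mapsto g\cdot x$ is $\omega$-automatic. -/

import Mathlib

open Filter

/-! ### ω-words, Büchi automata, ω-automatic representations of the reals -/

/-- An `ω`-word over an alphabet with a distinguished symbol `0`: a map `k ↦ a k` from `ℤ` to the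
alphabet such that all `a h` with `h` large enough are `0`. It is read in the order
`a k, a (k - 1), a (k - 2), …`. -/
def OmegaWord (A : Type) [Zero A] : Type :=
  {a : ℤ → A // ∃ k : ℤ, ∀ h > k, a h = 0}

/-- Büchi acceptance of an infinite sequence of letters by a nondeterministic automaton: some run
visits accepting states infinitely often. -/
def BuchiAccepts {A σ : Type} (M : NFA A σ) (w : ℕ → A) : Prop :=
  ∃ run : ℕ → σ, run 0 ∈ M.start ∧ (∀ i, run (i + 1) ∈ M.step (run i) (w i)) ∧
    ∃ᶠ i in atTop, run i ∈ M.accept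

/-- An `ω`-word is accepted if the automaton, started at some position `k` from which on upwards
all letters are `0` and reading `a k, a (k - 1), a (k - 2), …`, has an accepting run. -/
def OmegaAccepts {A σ : Type} [Zero A] (M : NFA A σ) (a : OmegaWord A) : Prop :=
  ∃ k : ℤ, (∀ h ≥ k, a.1 h = 0) ∧ BuchiAccepts M (fun i : ℕ => a.1 (k - i))

/-- A set of `ω`-words is `ω`-regular if some finite automaton accepts exactly its members. -/
def IsOmegaRegular {A : Type} [Zero A] (L : Set (OmegaWord A)) : Prop :=
  ∃ (σ : Type) (_ : Finite σ) (M : NFA A σ), ∀ a : OmegaWord A, a ∈ L ↔ OmegaAccepts M a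

/-- The convolution of an `n`-tuple of `ω`-words: the `ω`-word of `n`-tuples of letters, with
letters at the same position in `ℤ` aligned. -/
def omegaConv {A : Type} [Zero A] {n : ℕ} (x : Fin n → OmegaWord A) : OmegaWord (Fin n → A) :=
  ⟨fun k i => (x i).1 k, by
    choose k hk using fun i => (x i).2
    refine ⟨∑ i, |k i|, fun h hh => funext fun i => hk i h ?_⟩
    have h1 : |k i| ≤ ∑ j, |k j| :=
      Finset.single_le_sum (fun j _ => abs_nonneg (k j)) (Finset.mem_univ i)
    have h2 := le_abs_self (k i)
    omega⟩

/-- An `ω`-regular set of `ω`-words over a finite alphabet, each member of which denotes a real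
number, such that every real number has at least one representative. -/
structure RealOmegaRepresentation where
  /-- the alphabet -/
  A : Type
  [finA : Finite A]
  [zeroA : Zero A]
  /-- the set of representatives -/
  dom : Set (OmegaWord A)
  dom_regular : IsOmegaRegular dom
  /-- the real number denoted by a representative -/
  val : dom → ℝ
  val_surjective : Function.Surjective val

attribute [instance] RealOmegaRepresentation.finA RealOmegaRepresentation.zeroA

/-- The relation `R` on the reals is `ω`-automatic in the representation `ρ`: the convolutions of
all tuples of representatives which denote tuples in `R` form an `ω`-regular set. -/
def RealOmegaRepresentation.AutomaticRel (ρ : RealOmegaRepresentation) {n : ℕ}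
    (R : (Fin n → ℝ) → Prop) : Prop :=
  IsOmegaRegular {w | ∃ x : Fin n → ρ.dom, R (fun i => ρ.val (x i)) ∧
    w = omegaConv (fun i => (x i : OmegaWord ρ.A))}

/-- The function `f` on the reals is `ω`-automatic in the representation `ρ`: its graph
`{(x₁, …, xₙ, y) : f (x₁, …, xₙ) = y}` is `ω`-automatic. -/
def RealOmegaRepresentation.AutomaticFun (ρ : RealOmegaRepresentation) {n : ℕ}
    (f : (Fin n → ℝ) → ℝ) : Prop :=
  ρ.AutomaticRel (n := n + 1) (fun v => f (fun i => v i.castSucc) = v (Fin.last n))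

/-! ### The rings -/

/-- The value at `u` of the Laurent polynomial `∑ k, p k * x ^ k` with integer coefficients. -/
noncomputable def laurentValue (p : ℤ →₀ ℤ) (u : ℝ) : ℝ :=
  p.sum fun k a => (a : ℝ) * u ^ k

/-- The coefficients of the polynomial `p` after `j` passes through the loop of algorithm `C`
which starts at the position `s`. The pass number `j` (counted from `0`) works at position
`k = s - j`, and replaces the current polynomial by the current polynomial minus
`a * x ^ k * p₃`, where `a` is its coefficient at `x ^ k`. -/
def algC (p₃ p : ℤ →₀ ℤ) (s : ℤ) : ℕ → ℤ → ℤ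
  | 0 => fun i => p i
  | j + 1 => fun i => algC p₃ p s j i - algC p₃ p s j (s - j) * p₃ (i - (s - j))

/-- One of the coefficients at `k, k - 1, …, k - h + 1` exceeds its bound in absolute value. -/
def Overshoots (h : ℕ) (bound : ℕ → ℝ) (a : ℤ → ℤ) (k : ℤ) : Prop :=
  ∃ i < h, bound i < |(a (k - i) : ℝ)|

/-- The termination condition of algorithm `C`, for inputs `p = ∑_{k = -m, …, n} a_k x ^ k` with
integer coefficients of absolute value at most `3 * E`. The algorithm starts at `k = n + h`, and
makes passes while `-m < k` and no coefficient in the window `k, …, k - h + 1` exceeds its bound.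
The condition: if it stops at some `k > -m` because of an overshooting coefficient, then the value
of the window is larger than any possible value of the part not yet processed. -/
def AlgCTerminates (u : ℝ) (h : ℕ) (bound : ℕ → ℝ) (p₃ : ℤ →₀ ℤ) (E : ℤ) : Prop :=
  ∀ (m n : ℕ) (p : ℤ →₀ ℤ), (∀ k : ℤ, p k ≠ 0 → -(m : ℤ) ≤ k ∧ k ≤ n) →
    (∀ k : ℤ, |p k| ≤ 3 * E) →
    ∀ (j : ℕ) (k : ℤ), k = n + h - j → -(m : ℤ) < k →
      (∀ i < j, ¬ Overshoots h bound (algC p₃ p (n + h) i) (n + h - i)) →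
      Overshoots h bound (algC p₃ p (n + h) j) k →
      u ^ (k - h) / (1 - u⁻¹) * (3 * (E : ℝ)) <
        |∑ i ∈ Finset.range h, u ^ (k - i) * (algC p₃ p (n + h) j (k - i) : ℝ)|

/-- The data from which the general method constructs a ring containing `1 / b` and `c`.
The value `b = 1` is the case in which no division is asked for. The bound on the coefficients in
the window of algorithm `C` may depend on the place in the window; a constant function `bound` is
the case of a flat bound. -/
structure GridData where
  b : ℕ
  one_le_b : 1 ≤ b
  c : ℝ
  /-- `c` is a root of an integer -/
  c_root : ∃ (r : ℕ) (z : ℤ), 1 ≤ r ∧ c ^ r = z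
  u : ℝ
  one_lt_u : 1 < u
  p₁ : ℤ →₀ ℤ
  p₁_value : laurentValue p₁ u = 1 / b
  p₂ : ℤ →₀ ℤ
  p₂_value : laurentValue p₂ u = c
  h : ℕ
  p₃ : ℤ →₀ ℤ
  p₃_support : ∀ k : ℤ, p₃ k ≠ 0 → -(h : ℤ) + 1 ≤ k ∧ k ≤ 0
  p₃_zero : p₃ 0 = 1
  p₃_value : laurentValue p₃ u = 0
  p₄ : ℤ →₀ ℤ
  ℓ : ℤ
  p₄_value : laurentValue p₄ u = 0
  p₄_dominant : ∑ k ∈ p₄.support.erase ℓ, |p₄ k| < p₄ ℓ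
  bound : ℕ → ℝ
  bound_gt : ∀ i < h, 3 * ((|p₄ ℓ| : ℤ) : ℝ) < bound i
  terminates : AlgCTerminates u h bound p₃ |p₄ ℓ|

/-- The set `S` of all sums `∑_{k = -m, …, n} a_k u ^ k` with `a_k ∈ ℤ` and `|a_k| < |e_ℓ|`. -/
def GridData.values (D : GridData) : Set ℝ :=
  {x | ∃ a : ℤ →₀ ℤ, (∀ k, |a k| < |D.p₄ D.ℓ|) ∧ x = laurentValue a D.u}

/-- The subrings of the reals which are constructed as semiautomatic rings: those obtained by the
general method, and the concrete ones `𝔻_b`, `𝔻₂[√2]`, `𝔻_b[√(b² - 1)]`, `ℤ[∛7]` and `𝔻₂[∛65]`,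
where `𝔻_b = ℤ[1/b]`. -/
inductive ConstructedGrid : Subring ℝ → Prop
  | general (D : GridData) (G : Subring ℝ) (hG : (G : Set ℝ) = D.values) : ConstructedGrid G
  | adic (b : ℕ) (hb : 2 ≤ b) : ConstructedGrid (Subring.closure {(b : ℝ)⁻¹})
  | sqrtTwo : ConstructedGrid (Subring.closure {(2 : ℝ)⁻¹, Real.sqrt 2})
  | sqrtSqSubOne (b : ℕ) (hb : 2 ≤ b) :
      ConstructedGrid (Subring.closure {(b : ℝ)⁻¹, Real.sqrt ((b : ℝ) ^ 2 - 1)})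
  | cbrtSeven : ConstructedGrid (Subring.closure {(7 : ℝ) ^ (1 / 3 : ℝ)})
  | cbrtSixtyFive : ConstructedGrid (Subring.closure {(2 : ℝ)⁻¹, (65 : ℝ) ^ (1 / 3 : ℝ)})

/-! Everything rests on a base `u > 1` with two properties: `G` lies in `ℤ[u, 1/u]`, and for each
digit bound only finitely many sums `∑ a_i u^i`, `i ≥ 0`, with digits within the bound fall into a
given bounded interval (`LocallyFiniteDigitSums`). Reals are written in base `u` with digits `-d, …,
d`, redundantly, so that every word is a representative.

Each required relation is a condition on the sign of a linear form `∑ c_i v_i` with `c_i ∈ ℤ[u,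
1/u]`. An automaton reading the digits from the top keeps the Horner remainder `s ↦ u * s + δ`. Once
`|s|` exceeds `C = B / (u - 1)`, where `B` bounds the weights `δ`, the unread digits cannot reverse
the sign, so all remainders beyond `C`, or below `-C`, share a state. Multiplying by a fixed power
of `u` turns remainders into sums with bounded integer digits, so local finiteness leaves finitely
many states (`automaticRel_sign`).

Local finiteness has two sources. For the general method, run algorithm `C` on a digit sum with `|s|
≤ 3E / (u - 1)`: an overshoot would make the window too large to be balanced by `s` and the
unprocessed tail, so the final window is bounded and determines `s` (`GridData.finite_remainders`).
Splitting off sums with smaller digits extends this to all digit bounds and intervals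
(`locallyFiniteDigitSums_of_finite`). For the concrete rings `u` is a Pisot number, and algebraic
integers of a number field with all conjugates bounded are finite in number
(`locallyFiniteDigitSums_of_roots`). -/

/-! ### Sums with bounded integer digits -/

/-- `DigitSum u D s`: the number `s` is a finite sum `∑ a i * u ^ i` over `i ≥ 0` with integers
`a i` such that `|a i| ≤ D`. -/
inductive DigitSum (u : ℝ) (D : ℕ) : ℝ → Prop
  | zero : DigitSum u D 0
  | step (s : ℝ) (a : ℤ) : |a| ≤ D → DigitSum u D s → DigitSum u D (u * s + a)

namespace DigitSum

variable {u : ℝ} {D D' : ℕ} {s t : ℝ}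

theorem mono (h : D ≤ D') (hs : DigitSum u D s) : DigitSum u D' s := by
  induction hs with
  | zero => exact .zero
  | step s a ha _ ih => exact .step s a (ha.trans (by exact_mod_cast h)) ih

theorem add (hs : DigitSum u D s) (ht : DigitSum u D' t) : DigitSum u (D + D') (s + t) := by
  induction hs generalizing t with
  | zero => simpa using ht.mono (Nat.le_add_left _ _)
  | step s a ha hs ih =>
    cases ht with
    | zero => simpa using (DigitSum.step s a ha hs).mono (Nat.le_add_right _ _)
    | step t b hb ht =>
      have h := DigitSum.step (s + t) (a + b) ((abs_add_le a b).trans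
        (by push_cast; exact add_le_add ha hb)) (ih ht)
      convert! h using 1
      push_cast
      ring

theorem neg (hs : DigitSum u D s) : DigitSum u D (-s) := by
  induction hs with
  | zero => simpa using DigitSum.zero
  | step s a ha _ ih =>
    convert! DigitSum.step (-s) (-a) (by simpa using ha) ih using 1
    push_cast
    ring

theorem mul_base (hs : DigitSum u D s) : DigitSum u D (u * s) := by
  simpa using DigitSum.step s 0 (by simp) hs

theorem mul_base_pow (M : ℕ) (hs : DigitSum u D s) : DigitSum u D (u ^ M * s) := by
  induction M with
  | zero => simpa using hs
  | succ M ih =>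
    convert! ih.mul_base using 1
    ring

theorem split (hs : DigitSum u (D + D') s) :
    ∃ s₁ s₂, DigitSum u D s₁ ∧ DigitSum u D' s₂ ∧ s = s₁ + s₂ := by
  induction hs with
  | zero => exact ⟨0, 0, .zero, .zero, by simp⟩
  | step s a ha _ ih =>
    obtain ⟨s₁, s₂, h₁, h₂, rfl⟩ := ih
    rw [abs_le] at ha
    push_cast at ha
    -- The digit clamped to `[-D, D]`; the excess is at most `D'` in absolute value.
    let a₁ : ℤ := max (-D) (min D a)
    refine ⟨u * s₁ + a₁, u * s₂ + (a - a₁ : ℤ), .step _ _ ?_ h₁, .step _ _ ?_ h₂, ?_⟩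
    · rw [abs_le]; omega
    · rw [abs_le]; omega
    · push_cast; ring

theorem sum {ι : Type*} (I : Finset ι) (D : ι → ℕ) (s : ι → ℝ)
    (h : ∀ i ∈ I, DigitSum u (D i) (s i)) : DigitSum u (∑ i ∈ I, D i) (∑ i ∈ I, s i) := by
  classical
  induction I using Finset.induction_on with
  | empty => simpa using DigitSum.zero
  | insert i I hi ih =>
    rw [Finset.sum_insert hi, Finset.sum_insert hi]
    exact (h i (by simp)).add (ih fun j hj => h j (by simp [hj]))

end DigitSum

/-- In every bounded interval there are only finitely many sums with digits of bounded size. -/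
def LocallyFiniteDigitSums (u : ℝ) : Prop :=
  ∀ (D : ℕ) (C : ℝ), {s | DigitSum u D s ∧ |s| ≤ C}.Finite

/-- Multiplication by an element of `ℤ[u, 1/u]` is, up to a power of `u`, an operation on sums with
bounded digits. -/
theorem exists_digitSum_mul {u : ℝ} (hu : u ≠ 0) {c : ℝ}
    (hc : c ∈ Subring.closure ({u, u⁻¹} : Set ℝ)) :
    ∃ M : ℕ, ∀ D : ℕ, ∃ D' : ℕ, ∀ s, DigitSum u D s → DigitSum u D' (u ^ M * c * s) := by
  induction hc using Subring.closure_induction with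
  | mem x hx =>
    rcases hx with rfl | hx
    · exact ⟨0, fun D => ⟨D, fun s hs => by simpa using hs.mul_base⟩⟩
    · rw [Set.mem_singleton_iff] at hx
      subst hx
      exact ⟨1, fun D => ⟨D, fun s hs => by simpa [hu] using hs⟩⟩
  | zero => exact ⟨0, fun D => ⟨0, fun s _ => by simpa using DigitSum.zero⟩⟩
  | one => exact ⟨0, fun D => ⟨D, fun s hs => by simpa using hs⟩⟩
  | neg x _ ih =>
    obtain ⟨M, hM⟩ := ih
    refine ⟨M, fun D => ?_⟩
    obtain ⟨D', h⟩ := hM D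
    exact ⟨D', fun s hs => by simpa using (h s hs).neg⟩
  | add x y _ _ hx hy =>
    obtain ⟨M, hM⟩ := hx
    obtain ⟨N, hN⟩ := hy
    refine ⟨M + N, fun D => ?_⟩
    obtain ⟨D₁, h₁⟩ := hM D
    obtain ⟨D₂, h₂⟩ := hN D
    refine ⟨D₁ + D₂, fun s hs => ?_⟩
    convert! ((h₁ s hs).mul_base_pow N).add ((h₂ s hs).mul_base_pow M) using 1
    ring
  | mul x y _ _ hx hy =>
    obtain ⟨M, hM⟩ := hx
    obtain ⟨N, hN⟩ := hy
    refine ⟨M + N, fun D => ?_⟩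
    obtain ⟨D₂, h₂⟩ := hN D
    obtain ⟨D₁, h₁⟩ := hM D₂
    refine ⟨D₁, fun s hs => ?_⟩
    convert! h₁ _ (h₂ s hs) using 1
    ring

/-- Round to the nearest integer, with error at most `1 / 2 ≤ C`. If the rounded value leaves the
digit range, use the extreme digit on that side. -/
theorem exists_digit {d : ℕ} {C y : ℝ} (hC : 1 / 2 ≤ C) (hy : |y| ≤ C + d) :
    ∃ a : ℤ, |a| ≤ d ∧ |y - a| ≤ C := by
  rw [abs_le] at hy
  have hr := abs_le.1 (abs_sub_round y)
  rcases lt_or_ge (d : ℤ) (round y) with h | h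
  · have h' : (d : ℝ) + 1 ≤ round y := by exact_mod_cast h
    refine ⟨d, by simp, ?_⟩
    rw [abs_le]
    push_cast
    constructor <;> linarith
  rcases lt_or_ge (round y) (-(d : ℤ)) with h2 | h2
  · have h' : (round y : ℝ) + 1 ≤ -d := by exact_mod_cast h2
    refine ⟨-d, by simp, ?_⟩
    rw [abs_le]
    push_cast
    constructor <;> linarith
  · exact ⟨round y, abs_le.2 ⟨h2, h⟩, (abs_sub_round y).trans hC⟩

/-! ### Remainders -/

/-- The remainders of Horner's scheme for the weights `δ 0, δ 1, …`. -/
def hornerRemainder (u : ℝ) (δ : ℕ → ℝ) : ℕ → ℝ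
  | 0 => 0
  | n + 1 => u * hornerRemainder u δ n + δ n

theorem hornerRemainder_eq {u : ℝ} (hu : u ≠ 0) (δ : ℕ → ℝ) (n : ℕ) :
    hornerRemainder u δ n = u ^ n * ∑ i ∈ Finset.range n, δ i * u⁻¹ ^ (i + 1) := by
  induction n with
  | zero => simp [hornerRemainder]
  | succ n ih =>
    rw [hornerRemainder, ih, Finset.sum_range_succ, mul_add, mul_left_comm (u ^ (n + 1)),
      ← mul_pow, mul_inv_cancel₀ hu]
    ring

theorem hornerRemainder_sum {ι : Type*} (I : Finset ι) (u : ℝ) (c : ι → ℝ) (δ : ι → ℕ → ℝ)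
    (n : ℕ) : hornerRemainder u (fun j => ∑ i ∈ I, c i * δ i j) n =
      ∑ i ∈ I, c i * hornerRemainder u (δ i) n := by
  induction n with
  | zero => simp [hornerRemainder]
  | succ n ih =>
    simp only [hornerRemainder, ih, mul_add, Finset.sum_add_distrib, Finset.mul_sum]
    congr 1
    exact Finset.sum_congr rfl fun i _ => by ring

theorem digitSum_hornerRemainder (u : ℝ) {D : ℕ} (a : ℕ → ℤ) (ha : ∀ i, |a i| ≤ D) (n : ℕ) :
    DigitSum u D (hornerRemainder u (fun i => (a i : ℝ)) n) := by
  induction n with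
  | zero => exact .zero
  | succ n ih => exact .step _ _ (ha n) ih

theorem hasSum_geometric_bound {u : ℝ} (hu : 1 < u) (B : ℝ) :
    HasSum (fun i : ℕ => B * u⁻¹ ^ (i + 1)) (B / (u - 1)) := by
  have h := ((hasSum_geometric_of_lt_one (inv_nonneg.2 (by linarith))
    (inv_lt_one_of_one_lt₀ hu)).mul_left (B * u⁻¹))
  have h1 : u ≠ 0 := by linarith
  have h2 : u - 1 ≠ 0 := by linarith
  convert! h using 1
  · funext i; ring
  · have : 1 - u⁻¹ = (u - 1) * u⁻¹ := by field_simp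
    rw [this]
    field_simp

theorem norm_digit_le {u : ℝ} (hu : 1 < u) {δ : ℕ → ℝ} {B : ℝ} (hδ : ∀ i, |δ i| ≤ B) (i : ℕ) :
    ‖δ i * u⁻¹ ^ (i + 1)‖ ≤ B * u⁻¹ ^ (i + 1) := by
  have : 0 ≤ u⁻¹ ^ (i + 1) := by positivity
  rw [Real.norm_eq_abs, abs_mul, abs_of_nonneg this]
  exact mul_le_mul_of_nonneg_right (hδ i) this

theorem summable_digits {u : ℝ} (hu : 1 < u) {δ : ℕ → ℝ} {B : ℝ} (hδ : ∀ i, |δ i| ≤ B) :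
    Summable fun i => δ i * u⁻¹ ^ (i + 1) :=
  .of_norm_bounded (hasSum_geometric_bound hu B).summable (norm_digit_le hu hδ)

theorem abs_sub_hornerRemainder_le {u : ℝ} (hu : 1 < u) {δ : ℕ → ℝ} {B : ℝ}
    (hδ : ∀ i, |δ i| ≤ B) (n : ℕ) :
    |u ^ n * (∑' i, δ i * u⁻¹ ^ (i + 1)) - hornerRemainder u δ n| ≤ B / (u - 1) := by
  have hu0 : u ≠ 0 := by linarith
  have h := tsum_of_norm_bounded (hasSum_geometric_bound hu B)
    (norm_digit_le hu (δ := fun i => δ (i + n)) fun i => hδ (i + n))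
  rw [hornerRemainder_eq hu0, ← (summable_digits hu hδ).sum_add_tsum_nat_add n, mul_add,
    add_sub_cancel_left, ← tsum_mul_left]
  convert! h using 3
  funext i
  rw [mul_left_comm, show i + n + 1 = n + (i + 1) by ring, pow_add u⁻¹, ← mul_assoc (u ^ n),
    ← mul_pow, mul_inv_cancel₀ hu0, one_pow, one_mul]

/-! ### The automaton which computes the sign of a sum -/

/-- The sign of `s` when it exceeds `C` in absolute value, and `0` otherwise. -/
noncomputable def overflow (C s : ℝ) : SignType := if C < s then 1 else if s < -C then -1 else 0

/-- All numbers above `C` are identified with `C + 1`, all below `-C` with `-(C + 1)`. -/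
noncomputable def saturate (C s : ℝ) : ℝ :=
  if C < s then C + 1 else if s < -C then -(C + 1) else s

theorem overflow_saturate {C : ℝ} (hC : 0 ≤ C) (s : ℝ) :
    overflow C (saturate C s) = overflow C s := by
  unfold overflow saturate
  split_ifs <;> first | rfl | (exfalso; linarith)

/-- Beyond `C` the map `s ↦ u * s + e` never returns: `u * C - (u - 1) * C = C`. Hence replacing `s`
by any value on the same side, such as `C + 1`, loses nothing. -/
theorem saturate_step {u C e : ℝ} (hu : 1 < u) (hC : 0 ≤ C) (he : |e| ≤ (u - 1) * C) (s : ℝ) :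
    saturate C (u * saturate C s + e) = saturate C (u * s + e) := by
  rw [abs_le] at he
  by_cases h1 : C < s
  · have h2 : C < u * s + e := by nlinarith
    have h3 : C < u * (C + 1) + e := by nlinarith
    simp [saturate, h1, h2, h3]
  by_cases h2 : s < -C
  · have h3 : u * s + e < -C := by nlinarith
    have h4 : u * (-(C + 1)) + e < -C := by nlinarith
    have h5 : ¬ C < u * s + e := by linarith
    have h6 : ¬ C < u * (-(C + 1)) + e := by linarith
    simp only [saturate, h1, h2, h3, h4, h5, h6, if_true, if_false]
  · simp [saturate, h1, h2]

/-- If `V ≠ 0`, then `u ^ n * V` eventually exceeds `2 * C` in absolute value and carries `s n`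
beyond `C` on its side. If `V = 0`, then `s n` never leaves `[-C, C]`. -/
theorem eventually_overflow {u C V : ℝ} (hu : 1 < u) (s : ℕ → ℝ)
    (h : ∀ n, |u ^ n * V - s n| ≤ C) :
    ∀ᶠ n in atTop, overflow C (s n) = SignType.sign V := by
  have hC : 0 ≤ C := (abs_nonneg _).trans (h 0)
  rcases lt_trichotomy V 0 with hV | rfl | hV
  · have ht := (tendsto_pow_atTop_atTop_of_one_lt hu).atTop_mul_const (neg_pos.2 hV)
    filter_upwards [ht.eventually_gt_atTop (2 * C)] with n hn
    have := abs_le.1 (h n)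
    rw [overflow, if_neg (by nlinarith), if_pos (by nlinarith), sign_neg hV]
  · refine Eventually.of_forall fun n => ?_
    have := abs_le.1 (h n)
    rw [overflow, if_neg (by nlinarith), if_neg (by nlinarith), sign_zero]
  · have ht := (tendsto_pow_atTop_atTop_of_one_lt hu).atTop_mul_const hV
    filter_upwards [ht.eventually_gt_atTop (2 * C)] with n hn
    have := abs_le.1 (h n)
    rw [overflow, if_pos (by nlinarith), sign_pos hV]

/-- The automaton whose states are saturated remainders. -/
noncomputable def signNFA {A : Type} (u C : ℝ) (δ : A → ℝ) (F : Set ℝ) (P : SignType → Prop) :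
    NFA A F where
  step q a := {q' | (q' : ℝ) = saturate C (u * q + δ a)}
  start := {q | (q : ℝ) = 0}
  accept := {q | P (overflow C q)}

theorem buchiAccepts_signNFA {A : Type} {u B : ℝ} (hu : 1 < u) (hB : 0 ≤ B) {δ : A → ℝ}
    (hδ : ∀ a, |δ a| ≤ B) {F : Set ℝ}
    (hF : ∀ (w : ℕ → A) n, saturate (B / (u - 1)) (hornerRemainder u (fun i => δ (w i)) n) ∈ F)
    (P : SignType → Prop) (w : ℕ → A) :
    BuchiAccepts (signNFA u (B / (u - 1)) δ F P) w ↔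
      P (SignType.sign (∑' i, δ (w i) * u⁻¹ ^ (i + 1))) := by
  set C := B / (u - 1) with hCdef
  have hu1 : 0 < u - 1 := by linarith
  have hC : 0 ≤ C := div_nonneg hB hu1.le
  have hBC : (u - 1) * C = B := by rw [hCdef]; field_simp
  set s := hornerRemainder u (fun i => δ (w i)) with hs
  have hev : ∀ᶠ n in atTop, overflow C (s n) = SignType.sign (∑' i, δ (w i) * u⁻¹ ^ (i + 1)) :=
    eventually_overflow hu s (abs_sub_hornerRemainder_le hu fun i => hδ (w i))
  have hs0 : saturate C (s 0) = 0 := by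
    have h1 : ¬ C < 0 := by linarith
    simp [hs, hornerRemainder, saturate, h1]
  have hfreq : (∃ᶠ n in atTop, P (overflow C (s n))) ↔
      P (SignType.sign (∑' i, δ (w i) * u⁻¹ ^ (i + 1))) := by
    -- The condition is eventually constant in `n`, so holding infinitely often means holding in the
    -- limit.
    rw [frequently_congr (hev.mono fun n hn => by rw [hn])]
    exact frequently_const
  rw [← hfreq]
  constructor
  · rintro ⟨run, h0, hstep, hacc⟩
    have hrun : ∀ n, (run n : ℝ) = saturate C (s n) := by
      intro n
      induction n with
      | zero => rw [hs0]; exact h0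
      | succ n ih =>
        have h : (run (n + 1) : ℝ) = saturate C (u * run n + δ (w n)) := hstep n
        rw [h, ih, saturate_step hu hC (by rw [hBC]; exact hδ _)]
        rfl
    refine hacc.mono fun n hn => ?_
    have : P (overflow C (run n)) := hn
    rwa [hrun, overflow_saturate hC] at this
  · intro h
    refine ⟨fun n => ⟨saturate C (s n), hF w n⟩, hs0, fun n => ?_, h.mono fun n hn => ?_⟩
    · change saturate C (s (n + 1)) = saturate C (u * saturate C (s n) + δ (w n))
      rw [saturate_step hu hC (by rw [hBC]; exact hδ _)]
      rfl
    · change P (overflow C (saturate C (s n)))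
      rwa [overflow_saturate hC]

/-! ### Values of `ω`-words -/

theorem hasSum_omegaWord {A : Type} [Zero A] {u B : ℝ} (hu : 1 < u) {δ : A → ℝ} (h0 : δ 0 = 0)
    (hδ : ∀ a, |δ a| ≤ B) (a : OmegaWord A) {k : ℤ} (hk : ∀ h > k, a.1 h = 0) :
    HasSum (fun i : ℤ => δ (a.1 i) * u ^ i)
      (u ^ (k + 1) * ∑' i : ℕ, δ (a.1 (k - i)) * u⁻¹ ^ (i + 1)) := by
  have hinj : Function.Injective (fun i : ℕ => k - (i : ℤ)) := fun i j h => by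
    simp only at h; omega
  have hu0 : u ≠ 0 := by linarith
  rw [← hinj.hasSum_iff]
  · convert! ((summable_digits hu (δ := fun i : ℕ => δ (a.1 (k - i)))
      fun i => hδ _).hasSum).mul_left (u ^ (k + 1)) using 1
    funext i
    simp only [Function.comp]
    rw [mul_left_comm, ← zpow_natCast, inv_zpow', ← zpow_add₀ hu0]
    congr 2
    push_cast
    ring
  · intro j hj
    have : a.1 j = 0 := hk j (by
      by_contra hle
      exact hj ⟨(k - j).toNat, by simp only; omega⟩)
    rw [this, h0, zero_mul]

theorem exists_abs_le_of_finite {A : Type} [Finite A] (δ : A → ℝ) :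
    ∃ B, 0 ≤ B ∧ ∀ a, |δ a| ≤ B := by
  obtain ⟨B, hB⟩ := (Set.finite_range fun a => |δ a|).bddAbove
  exact ⟨max B 0, le_max_right _ _, fun a => (hB ⟨a, rfl⟩).trans (le_max_left _ _)⟩

theorem summable_omegaWord {A : Type} [Finite A] [Zero A] {u : ℝ} (hu : 1 < u) {δ : A → ℝ}
    (h0 : δ 0 = 0) (a : OmegaWord A) : Summable fun i : ℤ => δ (a.1 i) * u ^ i := by
  obtain ⟨B, -, hB⟩ := exists_abs_le_of_finite δ
  obtain ⟨k, hk⟩ := a.2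
  exact (hasSum_omegaWord hu h0 hB a hk).summable

/-- If only finitely many remainders lie in any bounded interval, then a condition on the sign of
the sum of the weights of an `ω`-word is `ω`-regular. -/
theorem isOmegaRegular_sign {A : Type} [Finite A] [Zero A] {u : ℝ} (hu : 1 < u) {δ : A → ℝ}
    (h0 : δ 0 = 0)
    (hfin : ∀ C : ℝ, {s | (∃ (w : ℕ → A) (n : ℕ), s = hornerRemainder u (fun i => δ (w i)) n) ∧
      |s| ≤ C}.Finite) (P : SignType → Prop) :
    IsOmegaRegular {a : OmegaWord A | P (SignType.sign (∑' k : ℤ, δ (a.1 k) * u ^ k))} := by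
  obtain ⟨B, hB0, hB⟩ := exists_abs_le_of_finite δ
  set C := B / (u - 1)
  let F : Set ℝ := {q | ∃ (w : ℕ → A) (n : ℕ),
    q = saturate C (hornerRemainder u (fun i => δ (w i)) n)}
  have hF : F.Finite := by
    refine ((hfin C).union (Set.toFinite {C + 1, -(C + 1)})).subset ?_
    rintro q ⟨w, n, rfl⟩
    unfold saturate
    split_ifs with h1 h2
    · simp
    · simp
    · exact Or.inl ⟨⟨w, n, rfl⟩, abs_le.2 ⟨by linarith, by linarith⟩⟩
  refine ⟨F, hF.to_subtype, signNFA u C δ F P, fun a => ?_⟩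
  -- Changing the starting position only rescales the sum by a positive power of `u`, so acceptance
  -- does not depend on it.
  have key : ∀ k : ℤ, (∀ h ≥ k, a.1 h = 0) →
      (BuchiAccepts (signNFA u C δ F P) (fun i : ℕ => a.1 (k - i)) ↔
        P (SignType.sign (∑' k : ℤ, δ (a.1 k) * u ^ k))) := by
    intro k hk
    rw [buchiAccepts_signNFA (F := F) hu hB0 hB (fun w n => ⟨w, n, rfl⟩),
      (hasSum_omegaWord hu h0 hB a fun h hh => hk h hh.le).tsum_eq, sign_mul,
      sign_pos (zpow_pos (by linarith) _), one_mul]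
  constructor
  · intro ha
    obtain ⟨k, hk⟩ := a.2
    have hk' : ∀ h ≥ k + 1, a.1 h = 0 := fun h hh => hk h (by omega)
    exact ⟨k + 1, hk', (key _ hk').2 ha⟩
  · rintro ⟨k, hk, hacc⟩
    exact (key k hk).1 hacc

/-! ### The representation in base `u` -/

/-- Integer digits of absolute value at most `d`. -/
abbrev Digit (d : ℕ) : Type := Set.Icc (-(d : ℤ)) d

instance (d : ℕ) : Zero (Digit d) := ⟨⟨0, by simp⟩⟩

theorem Digit.coe_zero (d : ℕ) : ((0 : Digit d) : ℤ) = 0 := rfl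

theorem Digit.abs_le {d : ℕ} (a : Digit d) : |(a : ℤ)| ≤ d := _root_.abs_le.2 a.2

/-- A greedy expansion: since `u * C = C + d`, some digit always brings the next remainder back into
`[-C, C]`. -/
theorem exists_digit_expansion {u : ℝ} (hu : 1 < u) {d : ℕ} (hd : u - 1 ≤ 2 * d) (t : ℝ)
    (ht : |t| ≤ d / (u - 1)) :
    ∃ a : ℕ → Digit d, ∑' i, ((a i : ℤ) : ℝ) * u⁻¹ ^ (i + 1) = t := by
  have hu1 : 0 < u - 1 := by linarith
  set C := (d : ℝ) / (u - 1) with hCdef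
  have hBC : (u - 1) * C = d := by rw [hCdef]; field_simp
  have hC : 1 / 2 ≤ C := by
    rw [hCdef, le_div_iff₀ hu1]; linarith
  have hex : ∀ s : Set.Icc (-C) C, ∃ a : Digit d, |u * s - (a : ℤ)| ≤ C := by
    intro s
    have hs := abs_le.2 s.2
    obtain ⟨a, ha, h⟩ := exists_digit (d := d) (y := u * s) hC (by
      rw [abs_mul, abs_of_pos (by linarith : (0 : ℝ) < u)]
      nlinarith)
    exact ⟨⟨a, abs_le.1 ha⟩, h⟩
  choose f hf using hex
  let r : ℕ → Set.Icc (-C) C := fun n =>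
    Nat.rec ⟨t, abs_le.1 ht⟩ (fun _ s => ⟨u * s - (f s : ℤ), abs_le.1 (hf s)⟩) n
  have hr : ∀ n, (r (n + 1)).1 = u * (r n).1 - ((f (r n) : ℤ) : ℝ) := fun n => rfl
  refine ⟨fun n => f (r n), ?_⟩
  have hrem : ∀ n, hornerRemainder u (fun i => ((f (r i) : ℤ) : ℝ)) n = u ^ n * t - (r n).1 := by
    intro n
    induction n with
    | zero => simp [hornerRemainder, r]
    | succ n ih =>
      rw [hornerRemainder, ih, hr]
      ring
  -- The error times `u ^ n` stays within `2 * C` for all `n`. Comparison with the zero sequence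
  -- then shows that the error has sign `0`.
  have hlim := eventually_overflow hu (C := C + C)
    (V := (∑' i, ((f (r i) : ℤ) : ℝ) * u⁻¹ ^ (i + 1)) - t) (fun _ => 0) (fun n => by
      have h1 := abs_sub_hornerRemainder_le hu (δ := fun i => ((f (r i) : ℤ) : ℝ)) (B := d)
        (fun i => by exact_mod_cast (f (r i)).abs_le) n
      have h2 := abs_le.2 (r n).2
      rw [hrem] at h1
      have := abs_sub _ _ |>.trans (add_le_add h1 h2)
      rw [sub_zero]
      convert! this using 2
      ring)
  obtain ⟨n, hn⟩ := hlim.exists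
  have h1 : ¬ (C + C < 0) := by linarith
  have h2 : ¬ (0 < -(C + C)) := by linarith
  rw [overflow, if_neg h1, if_neg h2, eq_comm, sign_eq_zero_iff] at hn
  linarith

theorem isOmegaRegular_univ (A : Type) [Zero A] :
    IsOmegaRegular (Set.univ : Set (OmegaWord A)) := by
  refine ⟨Unit, inferInstance, ⟨fun _ _ => Set.univ, Set.univ, Set.univ⟩, fun a => ?_⟩
  obtain ⟨k, hk⟩ := a.2
  refine ⟨fun _ => ⟨k + 1, fun h hh => hk h (by omega), fun _ => (), trivial, fun _ => trivial, ?_⟩,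
    fun _ => trivial⟩
  exact Frequently.of_forall fun _ => trivial

/-- The representation of the reals in base `u` with the integer digits `-d, …, d`. -/
noncomputable def baseRepresentation (u : ℝ) (hu : 1 < u) (d : ℕ) (hd : u - 1 ≤ 2 * d) :
    RealOmegaRepresentation where
  A := Digit d
  dom := Set.univ
  dom_regular := isOmegaRegular_univ _
  val a := ∑' k : ℤ, ((a.1.1 k : ℤ) : ℝ) * u ^ k
  val_surjective x := by
    have hu1 : 0 < u - 1 := by linarith
    have hC : 0 < (d : ℝ) / (u - 1) := div_pos (by linarith) hu1
    obtain ⟨N, hN⟩ := ((tendsto_pow_atTop_atTop_of_one_lt hu).atTop_mul_const hC).eventually_ge_atTop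
      |x| |>.exists
    have hpos : 0 < u ^ N := pow_pos (by linarith) N
    obtain ⟨a, ha⟩ := exists_digit_expansion hu hd (x / u ^ N) (by
      rw [abs_div, abs_of_pos hpos, div_le_iff₀ hpos]; linarith)
    let w : OmegaWord (Digit d) :=
      ⟨fun k => if k ≤ N - 1 then a (N - 1 - k).toNat else 0, N - 1, fun h hh => if_neg (by omega)⟩
    refine ⟨⟨w, trivial⟩, ?_⟩
    have h := hasSum_omegaWord hu (δ := fun a : Digit d => ((a : ℤ) : ℝ)) (B := d)
      (by simp [Digit.coe_zero]) (fun a => by exact_mod_cast a.abs_le) w (k := N - 1)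
      (fun h hh => if_neg (by omega))
    refine h.tsum_eq.trans ?_
    have hw : ∀ i : ℕ, w.1 (N - 1 - i) = a i := fun i => by
      simp only [w]
      rw [if_pos (by omega)]
      congr 1
      omega
    simp only [hw, ha, sub_add_cancel, zpow_natCast]
    field_simp

theorem automaticRel_sign {u : ℝ} (hu : 1 < u) (hfin : LocallyFiniteDigitSums u) {d : ℕ}
    (hd : u - 1 ≤ 2 * d) {n : ℕ} (c : Fin n → ℝ)
    (hc : ∀ i, c i ∈ Subring.closure ({u, u⁻¹} : Set ℝ)) (P : SignType → Prop) :
    (baseRepresentation u hu d hd).AutomaticRel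
      (fun v : Fin n → ℝ => P (SignType.sign (∑ i, c i * v i))) := by
  have hu0 : 0 < u := by linarith
  let δ : (Fin n → Digit d) → ℝ := fun a => ∑ i, c i * ((a i : ℤ) : ℝ)
  have h0 : δ 0 = 0 := by
    simp only [δ, Pi.zero_apply, Digit.coe_zero]
    simp
  have hreg := isOmegaRegular_sign (A := Fin n → Digit d) hu h0 (P := P) ?_
  · obtain ⟨σ, hσ, M, hM⟩ := hreg
    refine ⟨σ, hσ, M, fun w => Iff.trans ?_ (hM w)⟩
    have hval : ∀ w : OmegaWord (Fin n → Digit d), ∑' k : ℤ, δ (w.1 k) * u ^ k =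
        ∑ i, c i * ∑' k : ℤ, ((w.1 k i : ℤ) : ℝ) * u ^ k := by
      intro w
      simp only [δ, Finset.sum_mul, ← tsum_mul_left, mul_assoc]
      refine Summable.tsum_finsetSum fun i _ => Summable.mul_left _ ?_
      exact summable_omegaWord hu (δ := fun a : Fin n → Digit d => ((a i : ℤ) : ℝ))
        (by simp [Digit.coe_zero]) w
    constructor
    · rintro ⟨x, hx, rfl⟩
      exact (congrArg (fun t => P (SignType.sign t)) (hval _)).mpr hx
    · intro hw
      refine ⟨fun i => ⟨⟨fun k => w.1 k i, ?_⟩, trivial⟩, ?_, rfl⟩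
      · obtain ⟨k, hk⟩ := w.2
        exact ⟨k, fun h hh => congrFun (hk h hh) i⟩
      · exact (congrArg (fun t => P (SignType.sign t)) (hval _)).mp hw
  · intro C
    choose M hM using fun i => exists_digitSum_mul hu0.ne' (hc i)
    choose D hD using fun i => hM i d
    set N := ∑ i, M i
    -- The factor `u ^ N` clears the negative powers of `u` in all `c i` at once; scaling by it is
    -- injective.
    refine Set.Finite.of_finite_image (f := fun s => u ^ N * s)
      ((hfin (∑ i, D i) (u ^ N * C)).subset ?_)
      (mul_right_injective₀ (pow_ne_zero N hu0.ne')).injOn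
    rintro _ ⟨_, ⟨⟨w, m, rfl⟩, hs⟩, rfl⟩
    constructor
    · simp only [δ]
      rw [hornerRemainder_sum Finset.univ u c (fun i j => ((w j i : ℤ) : ℝ)), Finset.mul_sum]
      refine DigitSum.sum _ _ _ fun i _ => ?_
      have hMN : M i ≤ N := Finset.single_le_sum (fun j _ => Nat.zero_le (M j)) (Finset.mem_univ i)
      have h := (hD i _ (digitSum_hornerRemainder u (fun j => (w j i : ℤ))
        (fun j => (w j i).abs_le) m)).mul_base_pow (N - M i)
      convert! h using 1
      rw [← mul_assoc, ← mul_assoc, ← mul_assoc, ← pow_add, Nat.sub_add_cancel hMN]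
    · simp only
      rw [abs_mul, abs_of_pos (pow_pos hu0 N)]
      exact mul_le_mul_of_nonneg_left hs (pow_pos hu0 N).le

theorem exists_representation {u : ℝ} (hu : 1 < u) (hfin : LocallyFiniteDigitSums u)
    (G : Subring ℝ) (hG : G ≤ Subring.closure ({u, u⁻¹} : Set ℝ)) :
    ∃ ρ : RealOmegaRepresentation,
      ρ.AutomaticFun (fun v : Fin 2 → ℝ => v 0 + v 1) ∧
      ρ.AutomaticFun (fun v : Fin 2 → ℝ => v 0 - v 1) ∧
      ρ.AutomaticRel (fun v : Fin 2 → ℝ => v 0 = v 1) ∧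
      ρ.AutomaticRel (fun v : Fin 2 → ℝ => v 0 < v 1) ∧
      ρ.AutomaticRel (fun v : Fin 2 → ℝ => v 0 ≤ v 1) ∧
      ∀ g ∈ G, ρ.AutomaticFun (fun v : Fin 1 → ℝ => g * v 0) := by
  have hd : u - 1 ≤ 2 * (⌈u⌉₊ : ℝ) := by
    have := Nat.le_ceil u
    linarith
  have h1 := Subring.one_mem (Subring.closure ({u, u⁻¹} : Set ℝ))
  have hn1 := Subring.neg_mem _ h1
  have key : ∀ {n : ℕ} {R : (Fin n → ℝ) → Prop} (c : Fin n → ℝ) (P : SignType → Prop),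
      (∀ i, c i ∈ Subring.closure ({u, u⁻¹} : Set ℝ)) →
      (∀ v, R v ↔ P (SignType.sign (∑ i, c i * v i))) →
      (baseRepresentation u hu _ hd).AutomaticRel R := by
    intro n R c P hc hR
    rw [funext fun v => propext (hR v)]
    exact automaticRel_sign hu hfin hd c hc P
  refine ⟨baseRepresentation u hu _ hd,
    key ![1, 1, -1] (· = 0) (by intro i; fin_cases i <;> assumption) fun v => ?_,
    key ![1, -1, -1] (· = 0) (by intro i; fin_cases i <;> assumption) fun v => ?_,
    key ![1, -1] (· = 0) (by intro i; fin_cases i <;> assumption) fun v => ?_,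
    key ![1, -1] (· = -1) (by intro i; fin_cases i <;> assumption) fun v => ?_,
    key ![-1, 1] (0 ≤ ·) (by intro i; fin_cases i <;> assumption) fun v => ?_,
    fun g hg => key ![g, -1] (· = 0)
      (by intro i; fin_cases i <;> first | exact hG hg | assumption) fun v => ?_⟩
  · rw [sign_eq_zero_iff, ← sub_eq_zero]
    simp [Fin.sum_univ_succ, Fin.last, ← sub_eq_add_neg, ← add_sub_assoc]
  · rw [sign_eq_zero_iff, ← sub_eq_zero]
    simp [Fin.sum_univ_succ, Fin.last, sub_eq_add_neg, add_assoc]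
  · rw [sign_eq_zero_iff, ← sub_eq_zero]
    simp [Fin.sum_univ_succ, ← sub_eq_add_neg]
  · rw [sign_eq_neg_one_iff, ← sub_neg]
    simp [Fin.sum_univ_succ, ← sub_eq_add_neg]
  · rw [sign_nonneg_iff, ← sub_nonneg]
    simp [Fin.sum_univ_succ, sub_eq_neg_add]
  · rw [sign_eq_zero_iff, ← sub_eq_zero]
    simp [Fin.sum_univ_succ, Fin.last, ← sub_eq_add_neg]

/-! ### Local finiteness from one finite set of remainders -/

/-- Horner's scheme with greedy digits: an approximation of `s / u` to within `C` is multiplied by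
`u` and corrected by one digit. -/
theorem exists_finite_approximations {u : ℝ} (hu : 1 < u) {E : ℕ} (hE : u - 1 ≤ E) (N : ℕ) :
    ∃ W : Set ℝ, W.Finite ∧ (∀ w ∈ W, DigitSum u E w) ∧
      ∀ s : ℝ, |s| ≤ E / (u - 1) * u ^ N → ∃ w ∈ W, |s - w| ≤ E / (u - 1) := by
  have hu1 : 0 < u - 1 := by linarith
  have hu0 : 0 < u := by linarith
  set C := (E : ℝ) / (u - 1) with hCdef
  have hBC : (u - 1) * C = E := by rw [hCdef]; field_simp
  have hC : 1 / 2 ≤ C := by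
    rw [hCdef, le_div_iff₀ hu1]; linarith
  induction N with
  | zero =>
    exact ⟨{0}, Set.finite_singleton 0, by rintro _ rfl; exact .zero,
      fun s hs => ⟨0, rfl, by simpa using hs⟩⟩
  | succ N ih =>
    obtain ⟨W, hW, hWE, happ⟩ := ih
    refine ⟨Set.image2 (fun (w : ℝ) (a : ℤ) => u * w + a) W (Set.Icc (-(E : ℤ)) E),
      hW.image2 _ (Set.finite_Icc _ _), ?_, fun s hs => ?_⟩
    · rintro _ ⟨w, hw, a, ha, rfl⟩
      exact .step w a (abs_le.2 ha) (hWE w hw)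
    · obtain ⟨w, hw, hsw⟩ := happ (s / u) (by
        rw [abs_div, abs_of_pos hu0, div_le_iff₀ hu0]
        linarith [hs, show C * u ^ (N + 1) = C * u ^ N * u by ring])
      have hy : |u * (s / u - w)| ≤ C + E := by
        rw [abs_mul, abs_of_pos hu0]
        nlinarith
      obtain ⟨a, ha, h⟩ := exists_digit hC hy
      refine ⟨_, ⟨w, hw, a, abs_le.1 ha, rfl⟩, ?_⟩
      convert! h using 2
      field_simp
      ring

/-- A sum `s` with digits up to `2E` is close to some `w` with digits up to `E` from a finite set,
and `s - w` lies in the given finite set. For larger digits this trades a `2E` part for an `E` part,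
lowering the digit bound by `E` at the price of a slightly larger interval. -/
theorem locallyFiniteDigitSums_of_finite {u : ℝ} (hu : 1 < u) {E : ℕ} (hE : u - 1 ≤ E)
    (hfin : {s | DigitSum u (3 * E) s ∧ |s| ≤ 3 * E / (u - 1)}.Finite) :
    LocallyFiniteDigitSums u := by
  have hu1 : 0 < u - 1 := by linarith
  have hE0 : (0 : ℝ) < E := by linarith
  have hC : 0 < (E : ℝ) / (u - 1) := div_pos hE0 hu1
  have hC3 : 3 * (E : ℝ) / (u - 1) = 3 * (E / (u - 1)) := by ring
  have hN : ∀ C : ℝ, ∃ N : ℕ, C ≤ E / (u - 1) * u ^ N := fun C =>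
    ((tendsto_pow_atTop_atTop_of_one_lt hu).const_mul_atTop hC).eventually_ge_atTop C |>.exists
  have hdiff : ∀ s w, DigitSum u (2 * E) s → DigitSum u E w → |s - w| ≤ E / (u - 1) →
      s - w ∈ {s | DigitSum u (3 * E) s ∧ |s| ≤ 3 * E / (u - 1)} := fun s w hs hw h => by
    refine ⟨?_, by rw [hC3]; linarith⟩
    rw [sub_eq_add_neg]
    exact (hs.add hw.neg).mono (by omega)
  have key : ∀ (m : ℕ) (C : ℝ), {s | DigitSum u ((m + 2) * E) s ∧ |s| ≤ C}.Finite := by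
    intro m
    induction m with
    | zero =>
      intro C
      obtain ⟨N, hN⟩ := hN C
      obtain ⟨W, hW, hWE, happ⟩ := exists_finite_approximations hu hE N
      refine (hW.image2 (· + ·) hfin).subset ?_
      rintro s ⟨hs, hsC⟩
      obtain ⟨w, hw, hsw⟩ := happ s (hsC.trans hN)
      exact ⟨w, hw, s - w, hdiff s w (by simpa using hs) (hWE w hw) hsw, by simp⟩
    | succ m ih =>
      intro C
      refine ((ih (C + 3 * E / (u - 1))).image2 (· + ·) hfin).subset ?_
      rintro s ⟨hs, hsC⟩
      obtain ⟨s₁, s₂, h₁, h₂, rfl⟩ := DigitSum.split (D := 2 * E) (D' := (m + 1) * E)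
        (hs.mono (le_of_eq (by ring)))
      obtain ⟨N, hN⟩ := hN |s₁|
      obtain ⟨W, hW, hWE, happ⟩ := exists_finite_approximations hu hE N
      obtain ⟨w, hw, hsw⟩ := happ s₁ hN
      have hf := hdiff s₁ w h₁ (hWE w hw) hsw
      refine ⟨w + s₂, ⟨((hWE w hw).add h₂).mono (le_of_eq (by ring)), ?_⟩, s₁ - w, hf,
        by simp only; ring⟩
      have h := abs_sub (s₁ + s₂) (s₁ - w)
      rw [show s₁ + s₂ - (s₁ - w) = w + s₂ by ring] at h
      exact h.trans (add_le_add hsC hf.2)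
  intro D C
  refine (key D C).subset fun s hs => ⟨hs.1.mono ?_, hs.2⟩
  have : 1 ≤ E := by exact_mod_cast hE0
  nlinarith

/-! ### Laurent polynomials -/

theorem laurentValue_add (p q : ℤ →₀ ℤ) (u : ℝ) :
    laurentValue (p + q) u = laurentValue p u + laurentValue q u :=
  Finsupp.sum_add_index' (by simp) fun k a b => by push_cast; ring

theorem laurentValue_smul (c : ℤ) (p : ℤ →₀ ℤ) (u : ℝ) :
    laurentValue (c • p) u = c * laurentValue p u := by
  unfold laurentValue
  rw [Finsupp.sum_smul_index (by simp), Finsupp.mul_sum]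
  exact Finsupp.sum_congr fun k _ => by push_cast; ring

theorem laurentValue_shift (p : ℤ →₀ ℤ) {u : ℝ} (hu : u ≠ 0) (k : ℤ) :
    laurentValue (p.equivMapDomain (Equiv.addRight k)) u = u ^ k * laurentValue p u := by
  unfold laurentValue
  rw [Finsupp.sum_equivMapDomain, Finsupp.mul_sum]
  refine Finsupp.sum_congr fun i _ => ?_
  rw [Equiv.coe_addRight, zpow_add₀ hu]
  ring

theorem laurentValue_mem_closure (p : ℤ →₀ ℤ) (u : ℝ) :
    laurentValue p u ∈ Subring.closure ({u, u⁻¹} : Set ℝ) := by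
  refine Subring.sum_mem _ fun k _ => Subring.mul_mem _ (intCast_mem _ _) ?_
  obtain ⟨n, rfl | rfl⟩ := k.eq_nat_or_neg
  · rw [zpow_natCast]
    exact Subring.pow_mem _ (Subring.subset_closure (by simp)) n
  · rw [zpow_neg, zpow_natCast, ← inv_pow]
    exact Subring.pow_mem _ (Subring.subset_closure (by simp)) n

theorem laurentValue_eq_sum_range {p : ℤ →₀ ℤ} {n : ℕ}
    (hp : ∀ k : ℤ, p k ≠ 0 → 0 ≤ k ∧ k < n) (u : ℝ) :
    laurentValue p u = ∑ i ∈ Finset.range n, (p i : ℝ) * u ^ i := by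
  unfold laurentValue
  rw [Finsupp.sum_of_support_subset p (s := (Finset.range n).map Nat.castEmbedding) ?_ _ (by simp)]
  · simp
  · intro k hk
    have h := hp k (Finsupp.mem_support_iff.1 hk)
    simp only [Finset.mem_map, Finset.mem_range]
    exact ⟨k.toNat, by omega, by simp [h.1]⟩

theorem DigitSum.exists_laurent {u : ℝ} (hu : u ≠ 0) {D : ℕ} {s : ℝ} (hs : DigitSum u D s) :
    ∃ (n : ℕ) (p : ℤ →₀ ℤ), (∀ k : ℤ, p k ≠ 0 → 0 ≤ k ∧ k ≤ n) ∧ (∀ k, |p k| ≤ D) ∧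
      laurentValue p u = s := by
  induction hs with
  | zero => exact ⟨0, 0, by simp, by simp, by simp [laurentValue]⟩
  | step s a ha _ ih =>
    obtain ⟨n, p, hp, hD, rfl⟩ := ih
    have hval : ∀ k, (p.equivMapDomain (Equiv.addRight (1 : ℤ)) + Finsupp.single 0 a : ℤ →₀ ℤ) k =
        if k = 0 then a else p (k - 1) := by
      intro k
      rw [Finsupp.add_apply, Finsupp.equivMapDomain_apply, Finsupp.single_apply]
      by_cases h : k = 0
      · have : p (-1) = 0 := by
          by_contra h
          have := hp _ h
          omega
        simp [h, this]
      · simp [h, Ne.symm h, sub_eq_add_neg]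
    refine ⟨n + 1, p.equivMapDomain (Equiv.addRight 1) + Finsupp.single 0 a, fun k hk => ?_,
      fun k => ?_, ?_⟩
    · rw [hval] at hk
      split_ifs at hk with h
      · omega
      · have := hp _ hk
        push_cast
        omega
    · rw [hval]
      split_ifs
      exacts [ha, hD _]
    · rw [laurentValue_add, laurentValue_shift _ hu]
      simp [laurentValue]

theorem sum_zpow_le {u : ℝ} (hu : 1 < u) (S : Finset ℤ) (K : ℤ) (hS : ∀ k ∈ S, k < K) :
    ∑ k ∈ S, u ^ k ≤ u ^ K / (u - 1) := by
  have hu1 : 0 < u - 1 := by linarith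
  have hu0 : 0 < u := by linarith
  induction S using Finset.induction_on_max generalizing K with
  | empty => simpa using div_nonneg (zpow_pos hu0 K).le hu1.le
  | insert a S ha ih =>
    have haS : a ∉ S := fun h => lt_irrefl _ (ha a h)
    have haK : a + 1 ≤ K := hS a (by simp)
    have h := ih a ha
    have hle : u ^ (a + 1) / (u - 1) ≤ u ^ K / (u - 1) :=
      div_le_div_of_nonneg_right (zpow_le_zpow_right₀ hu.le haK) hu1.le
    rw [Finset.sum_insert haS]
    refine le_trans ?_ hle
    rw [zpow_add_one₀ hu0.ne']
    rw [le_div_iff₀ hu1] at h ⊢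
    nlinarith

/-- A zero `u > 1` of a Laurent polynomial with one dominant coefficient `e` satisfies
`u - 1 ≤ e`. -/
theorem root_le_of_dominant {u : ℝ} (hu : 1 < u) (p : ℤ →₀ ℤ) (ℓ : ℤ)
    (hdom : ∑ k ∈ p.support.erase ℓ, |p k| < p ℓ) (h0 : laurentValue p u = 0) :
    u - 1 ≤ (p ℓ : ℝ) := by
  have hu1 : 0 < u - 1 := by linarith
  have hu0 : 0 < u := by linarith
  have hpos : 0 < p ℓ := lt_of_le_of_lt (Finset.sum_nonneg fun _ _ => abs_nonneg _) hdom
  have hle : ∀ k, |p k| ≤ p ℓ := by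
    intro k
    by_cases hk : k = ℓ
    · rw [hk, abs_of_pos hpos]
    by_cases hk0 : p k = 0
    · simp [hk0, hpos.le]
    · exact (Finset.single_le_sum (f := fun k => |p k|) (fun _ _ => abs_nonneg _)
        (Finset.mem_erase.2 ⟨hk, Finsupp.mem_support_iff.2 hk0⟩)).trans hdom.le
  have hne : p.support.Nonempty := ⟨ℓ, Finsupp.mem_support_iff.2 hpos.ne'⟩
  -- Cauchy's root bound: the leading coefficient is a nonzero integer, so `u ^ K` is at most `p ℓ`
  -- times the sum of the lower powers, which is below `u ^ K / (u - 1)`.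
  set K := p.support.max' hne
  have hK : K ∈ p.support := Finset.max'_mem _ _
  have hsum := h0
  unfold laurentValue at hsum
  rw [Finsupp.sum, ← Finset.add_sum_erase _ _ hK] at hsum
  have hlt : ∀ k ∈ p.support.erase K, k < K := fun k hk =>
    lt_of_le_of_ne (Finset.le_max' _ _ (Finset.mem_of_mem_erase hk)) (Finset.ne_of_mem_erase hk)
  have h1 : |∑ k ∈ p.support.erase K, (p k : ℝ) * u ^ k| ≤ p ℓ * (u ^ K / (u - 1)) := by
    refine (Finset.abs_sum_le_sum_abs _ _).trans (le_trans ?_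
      (mul_le_mul_of_nonneg_left (sum_zpow_le hu _ K hlt) (by exact_mod_cast hpos.le)))
    rw [Finset.mul_sum]
    refine Finset.sum_le_sum fun k _ => ?_
    rw [abs_mul, abs_of_pos (zpow_pos hu0 k)]
    exact mul_le_mul_of_nonneg_right (by exact_mod_cast hle k) (zpow_pos hu0 k).le
  have h2 : u ^ K ≤ |(p K : ℝ) * u ^ K| := by
    rw [abs_mul, abs_of_pos (zpow_pos hu0 K)]
    refine le_mul_of_one_le_left (zpow_pos hu0 K).le ?_
    exact_mod_cast Int.one_le_abs (Finsupp.mem_support_iff.1 hK)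
  rw [eq_neg_of_add_eq_zero_left hsum, abs_neg] at h2
  have h3 := h2.trans h1
  rw [← mul_div_assoc, le_div_iff₀ hu1, mul_comm] at h3
  exact le_of_mul_le_mul_right h3 (zpow_pos hu0 K)

/-! ### The passes of algorithm `C` -/

/-- Each pass subtracts a multiple of a shift of `p₃`, which vanishes at `u`. -/
theorem exists_finsupp_algC {p₃ p : ℤ →₀ ℤ} {u : ℝ} (hu : u ≠ 0) (h₃ : laurentValue p₃ u = 0)
    (s : ℤ) (j : ℕ) :
    ∃ q : ℤ →₀ ℤ, (∀ i, q i = algC p₃ p s j i) ∧ laurentValue q u = laurentValue p u := by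
  induction j with
  | zero => exact ⟨p, fun _ => rfl, rfl⟩
  | succ j ih =>
    obtain ⟨q, hq, hv⟩ := ih
    refine ⟨q + (-q (s - j)) • p₃.equivMapDomain (Equiv.addRight (s - j)), fun i => ?_, ?_⟩
    · simp only [algC]
      rw [← hq, ← hq, Finsupp.add_apply, Finsupp.smul_apply, Finsupp.equivMapDomain_apply,
        Equiv.addRight_symm, Equiv.coe_addRight, smul_eq_mul, neg_mul, ← sub_eq_add_neg]
      simp only [sub_eq_add_neg]
    · rw [laurentValue_add, laurentValue_smul, laurentValue_shift _ hu, h₃, hv]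
      ring

theorem algC_eq_zero {h : ℕ} {p₃ p : ℤ →₀ ℤ} (hs : ∀ k : ℤ, p₃ k ≠ 0 → -(h : ℤ) + 1 ≤ k ∧ k ≤ 0)
    (h0 : p₃ 0 = 1) {s : ℤ} (hp : ∀ i, s < i → p i = 0) (j : ℕ) (i : ℤ) (hi : s - j < i) :
    algC p₃ p s j i = 0 := by
  induction j generalizing i with
  | zero => exact hp i (by simpa using hi)
  | succ j ih =>
    simp only [algC]
    rcases eq_or_ne i (s - j) with rfl | hne
    · simp [h0]
    · have hlt : s - j < i := by push_cast at hi; omega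
      have h3 : p₃ (i - (s - j)) = 0 := by
        by_contra h
        have := hs _ h
        omega
      rw [ih i hlt, h3]
      ring

theorem algC_eq_self {h : ℕ} {p₃ p : ℤ →₀ ℤ} (hs : ∀ k : ℤ, p₃ k ≠ 0 → -(h : ℤ) + 1 ≤ k ∧ k ≤ 0)
    {s : ℤ} (j : ℕ) (i : ℤ) (hi : i ≤ s - j - h + 1) : algC p₃ p s j i = p i := by
  induction j with
  | zero => rfl
  | succ j ih =>
    push_cast at hi
    have h3 : p₃ (i - (s - j)) = 0 := by
      by_contra h
      have := hs _ h
      omega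
    simp only [algC]
    rw [ih (by omega), h3]
    ring

/-- The value of the input as the value of the part not yet processed and that of the window. -/
theorem laurentValue_eq_tail_add_window {h n : ℕ} {p₃ p : ℤ →₀ ℤ} {u : ℝ} (hu : u ≠ 0)
    (hs : ∀ k : ℤ, p₃ k ≠ 0 → -(h : ℤ) + 1 ≤ k ∧ k ≤ 0) (h0 : p₃ 0 = 1)
    (h₃ : laurentValue p₃ u = 0) (hp : ∀ k : ℤ, p k ≠ 0 → 0 ≤ k ∧ k ≤ n) {j t : ℕ}
    (hjt : j + t = n + 1) :
    laurentValue p u = ∑ i ∈ Finset.range t, (p i : ℝ) * u ^ i +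
      ∑ i ∈ Finset.range h, u ^ ((n : ℤ) + h - j - i) *
        (algC p₃ p (n + h) j ((n : ℤ) + h - j - i) : ℝ) := by
  obtain ⟨q, hq, hv⟩ := exists_finsupp_algC (p := p) hu h₃ (n + h) j
  have hqs : ∀ k : ℤ, q k ≠ 0 → 0 ≤ k ∧ k < (t + h : ℕ) := by
    intro k hk
    rw [hq] at hk
    constructor
    · by_contra hneg
      refine hk ?_
      rw [algC_eq_self hs j k (by omega)]
      by_contra hpk
      exact hneg (hp k hpk).1
    · by_contra hge
      refine hk (algC_eq_zero hs h0 (fun i hi => ?_) j k (by push_cast at hge; omega))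
      by_contra hpi
      have := hp i hpi
      omega
  rw [← hv, laurentValue_eq_sum_range hqs, Finset.sum_range_add]
  congr 1
  · refine Finset.sum_congr rfl fun i hi => ?_
    rw [Finset.mem_range] at hi
    rw [hq, algC_eq_self hs j i (by omega)]
  · rw [← Finset.sum_range_reflect]
    refine Finset.sum_congr rfl fun i hi => ?_
    rw [Finset.mem_range] at hi
    have hidx : ((t + (h - 1 - i) : ℕ) : ℤ) = n + h - j - i := by omega
    rw [← zpow_natCast, hq, hidx, mul_comm]

theorem GridData.finite_remainders (D : GridData) :
    {s | DigitSum D.u (3 * (D.p₄ D.ℓ).natAbs) s ∧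
      |s| ≤ 3 * ((D.p₄ D.ℓ).natAbs : ℝ) / (D.u - 1)}.Finite := by
  set u := D.u
  set E := (D.p₄ D.ℓ).natAbs with hE
  have hEabs : ((|D.p₄ D.ℓ| : ℤ) : ℝ) = E := by
    rw [hE, ← Int.natCast_natAbs]; simp
  have hu : 1 < u := D.one_lt_u
  have hu0 : u ≠ 0 := by linarith
  have hu1 : 0 < u - 1 := by linarith
  let f : (Fin D.h → ℤ) → ℝ := fun w => ∑ i : Fin D.h, u ^ ((D.h : ℤ) - 1 - (i : ℕ)) * (w i : ℝ)
  refine ((Set.finite_Icc (fun i : Fin D.h => -⌊D.bound i⌋) (fun i => ⌊D.bound i⌋)).image f).subset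
    ?_
  rintro s ⟨hs, hsC⟩
  obtain ⟨n, p, hp, hpE, rfl⟩ := hs.exists_laurent hu0
  have hsplit := fun (j t : ℕ) (hjt : j + t = n + 1) =>
    laurentValue_eq_tail_add_window hu0 D.p₃_support D.p₃_zero D.p₃_value hp hjt
  have hh : 1 ≤ D.h := by
    have := D.p₃_support 0 (by rw [D.p₃_zero]; exact one_ne_zero)
    omega
  have hno : ∀ j : ℕ, j ≤ n + 1 →
      ¬ Overshoots D.h D.bound (algC D.p₃ p (n + D.h) j) (n + D.h - j) := by
    intro j
    induction j using Nat.strong_induction_on with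
    | _ j ih =>
      intro hj hover
      obtain ⟨t, ht⟩ := Nat.exists_eq_add_of_le hj
      -- With `m = 1` the condition still covers `k = 0`, which is the last position needed when `h
      -- = 1`.
      have hterm := D.terminates 1 n p
        (fun k hk => ⟨by have := hp k hk; push_cast; omega, (hp k hk).2⟩)
        (fun k => (hpE k).trans (by rw [← Int.natCast_natAbs, ← hE]; push_cast; rfl)) j _ rfl
        (by push_cast; omega) (fun i hi => ih i hi (by omega)) hover
      rw [hEabs] at hterm
      have htail : |∑ i ∈ Finset.range t, (p i : ℝ) * u ^ i| ≤ 3 * E * ((u ^ t - 1) / (u - 1)) := by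
        refine (Finset.abs_sum_le_sum_abs _ _).trans ?_
        rw [← geom_sum_eq (by linarith), Finset.mul_sum]
        refine Finset.sum_le_sum fun i _ => ?_
        have hui : 0 < u ^ i := pow_pos (by linarith) i
        rw [abs_mul, abs_of_pos hui]
        exact mul_le_mul_of_nonneg_right (by exact_mod_cast hpE i) hui.le
      have hpow : u ^ ((n : ℤ) + D.h - j - D.h) / (1 - u⁻¹) = u ^ t / (u - 1) := by
        have hidx : (n : ℤ) + D.h - j - D.h = (t : ℤ) - 1 := by omega
        have h1 : 1 - u⁻¹ = (u - 1) / u := by field_simp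
        rw [hidx, zpow_sub_one₀ hu0, zpow_natCast, h1]
        field_simp
      change u ^ ((n : ℤ) + D.h - j - D.h) / (1 - u⁻¹) * (3 * (E : ℝ)) < _ at hterm
      rw [hpow] at hterm
      have hv := hsplit j t ht.symm
      rw [← sub_eq_iff_eq_add'] at hv
      have habs := abs_sub (laurentValue p u) (∑ i ∈ Finset.range t, (p i : ℝ) * u ^ i)
      rw [hv] at habs
      -- The bounds for `s` and the tail add up to exactly `3E * u ^ t / (u - 1)`, the threshold
      -- that an overshooting window must strictly exceed.
      have hfinal := hterm.trans_le (habs.trans (add_le_add hsC htail))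
      refine lt_irrefl _ (hfinal.trans_le (le_of_eq ?_))
      field_simp
      ring
  -- After `n + 1` passes the tail is empty and the window occupies positions `h - 1, …, 0`.
  have hlast := hno (n + 1) le_rfl
  have hv := hsplit (n + 1) 0 (by omega)
  refine ⟨fun i => algC D.p₃ p (n + D.h) (n + 1) ((n : ℤ) + D.h - (n + 1 : ℕ) - (i : ℕ)), ?_, ?_⟩
  · have hb : ∀ i : Fin D.h, |algC D.p₃ p (n + D.h) (n + 1)
        ((n : ℤ) + D.h - (n + 1 : ℕ) - (i : ℕ))| ≤ ⌊D.bound i⌋ := by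
      intro i
      rw [Int.le_floor]
      push_cast
      by_contra hlt
      exact hlast ⟨i, i.2, by push_cast; exact not_le.1 hlt⟩
    exact ⟨fun i => (abs_le.1 (hb i)).1, fun i => (abs_le.1 (hb i)).2⟩
  · rw [hv, Finset.sum_range_zero, zero_add, Finset.sum_range]
    refine Finset.sum_congr rfl fun i _ => ?_
    congr 2
    push_cast
    ring

theorem GridData.locallyFiniteDigitSums (D : GridData) : LocallyFiniteDigitSums D.u := by
  refine locallyFiniteDigitSums_of_finite D.one_lt_u ?_ D.finite_remainders
  have h := root_le_of_dominant D.one_lt_u D.p₄ D.ℓ D.p₄_dominant D.p₄_value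
  refine h.trans ?_
  rw [Nat.cast_natAbs]
  exact_mod_cast le_abs_self _

theorem GridData.values_subset_closure (D : GridData) :
    D.values ⊆ Subring.closure ({D.u, D.u⁻¹} : Set ℝ) := by
  rintro _ ⟨a, -, rfl⟩
  exact laurentValue_mem_closure a D.u

/-! ### Pisot numbers -/

/-- If `u` is a root of a monic integer polynomial whose other complex roots lie inside the unit
circle, then the sums with bounded digits in base `u` are locally finite. -/
theorem locallyFiniteDigitSums_of_roots {u : ℝ} (f : Polynomial ℤ) (hf : f.Monic)
    (hfu : Polynomial.aeval u f = 0)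
    (hroots : ∀ z : ℂ, Polynomial.aeval z f = 0 → z = u ∨ ‖z‖ < 1) : LocallyFiniteDigitSums u := by
  have huZ : IsIntegral ℤ u := ⟨f, hf, hfu⟩
  have huQ : IsIntegral ℚ u := huZ.tower_top
  let K := IntermediateField.adjoin ℚ {u}
  have : FiniteDimensional ℚ K := IntermediateField.adjoin.finiteDimensional huQ
  have : NumberField K := ⟨⟩
  let g : K := IntermediateField.AdjoinSimple.gen ℚ u
  have hg : (g : ℝ) = u := rfl
  have hinj : Function.Injective (fun x : K => (x : ℝ)) := Subtype.val_injective
  have hgZ : IsIntegral ℤ g :=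
    (isIntegral_algHom_iff ((IntermediateField.val K).restrictScalars ℤ) hinj).1 huZ
  have hgf : Polynomial.aeval g f = 0 := by
    apply hinj
    have := Polynomial.aeval_algHom_apply ((IntermediateField.val K).restrictScalars ℤ) g f
    exact this.symm.trans hfu
  have hφ : ∀ φ : K →+* ℂ, φ g = u ∨ ‖φ g‖ < 1 := fun φ => hroots _ (by
    have := Polynomial.aeval_algHom_apply φ.toIntAlgHom g f
    rw [hgf, map_zero] at this
    exact this)
  intro D C
  -- Embeddings fixing `u` send the lift to `s`; under the others a geometric series bounds the
  -- conjugate.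
  have hlift : ∀ s, DigitSum u D s → ∃ x : K, (x : ℝ) = s ∧ IsIntegral ℤ x ∧ ∀ φ : K →+* ℂ,
      (φ g = u → φ x = s) ∧ (‖φ g‖ < 1 → ‖φ x‖ ≤ D / (1 - ‖φ g‖)) := by
    intro s hs
    induction hs with
    | zero =>
      exact ⟨0, rfl, isIntegral_zero, fun φ => ⟨fun _ => by simp, fun h => by
        simpa using div_nonneg (Nat.cast_nonneg D) (by linarith)⟩⟩
    | step s a ha _ ih =>
      obtain ⟨x, rfl, hx, h⟩ := ih
      refine ⟨g * x + a, ?_, (hgZ.mul hx).add isIntegral_algebraMap, fun φ => ⟨fun h1 => ?_,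
        fun h1 => ?_⟩⟩
      · push_cast
        rw [hg]
      · rw [map_add, map_mul, (h φ).1 h1, h1]
        simp
      · have h2 := (h φ).2 h1
        rw [map_add, map_mul, map_intCast]
        have h3 : ‖(a : ℂ)‖ ≤ D := by
          rw [Complex.norm_intCast]
          exact_mod_cast ha
        have h4 : 0 < 1 - ‖φ g‖ := by linarith
        refine (norm_add_le _ _).trans ?_
        rw [norm_mul]
        have h5 := add_le_add (mul_le_mul_of_nonneg_left h2 (norm_nonneg (φ g))) h3
        refine h5.trans (le_of_eq ?_)
        field_simp
        ring
  obtain ⟨B, hB⟩ := (Set.finite_range fun φ : K →+* ℂ => (D : ℝ) / (1 - ‖φ g‖)).bddAbove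
  refine ((NumberField.Embeddings.finite_of_norm_le K ℂ (max B C)).image
    (fun x : K => (x : ℝ))).subset ?_
  rintro s ⟨hs, hsC⟩
  obtain ⟨x, hxs, hx, h⟩ := hlift s hs
  refine ⟨x, ⟨hx, fun φ => ?_⟩, hxs⟩
  rcases hφ φ with h1 | h1
  · rw [(h φ).1 h1, Complex.norm_real]
    exact le_max_of_le_right hsC
  · exact le_max_of_le_left (((h φ).2 h1).trans (hB ⟨φ, rfl⟩))

theorem locallyFiniteDigitSums_natCast (b : ℕ) : LocallyFiniteDigitSums (b : ℝ) := by
  refine locallyFiniteDigitSums_of_roots (Polynomial.X - Polynomial.C (b : ℤ))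
    (Polynomial.monic_X_sub_C _) (by simp) fun z hz => Or.inl ?_
  simpa [sub_eq_zero] using hz

theorem locallyFiniteDigitSums_quadratic {u u' : ℝ} (P Q : ℤ) (hP : u + u' = P) (hQ : u * u' = Q)
    (hu' : |u'| < 1) : LocallyFiniteDigitSums u := by
  refine locallyFiniteDigitSums_of_roots
    (Polynomial.X ^ 2 - Polynomial.C P * Polynomial.X + Polynomial.C Q) (by monicity!) ?_
    fun z hz => ?_
  · simp only [map_add, map_sub, map_mul, map_pow, Polynomial.aeval_X, eq_intCast,
      map_intCast]
    rw [← hP, ← hQ]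
    ring
  · simp only [map_add, map_sub, map_mul, map_pow, Polynomial.aeval_X, eq_intCast,
      map_intCast] at hz
    have hP' : (u : ℂ) + u' = P := by exact_mod_cast congrArg ((↑) : ℝ → ℂ) hP
    have hQ' : (u : ℂ) * u' = Q := by exact_mod_cast congrArg ((↑) : ℝ → ℂ) hQ
    have h : (z - u) * (z - u') = 0 := by
      rw [← hP', ← hQ'] at hz
      linear_combination hz
    rcases mul_eq_zero.1 h with h | h
    · exact Or.inl (sub_eq_zero.1 h)
    · right
      rw [sub_eq_zero.1 h, Complex.norm_real]
      exact hu'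

/-- The other cube roots are `α` times the primitive cube roots of unity, with real part `-1 / 2`.
-/
theorem eq_or_re_eq_of_cube_eq {α : ℝ} (hα : 0 < α) {β : ℂ} (h : β ^ 3 = (α : ℂ) ^ 3) :
    β = α ∨ β.re = -α / 2 := by
  have h1 : (β - α) * (β ^ 2 + β * α + α ^ 2) = 0 := by linear_combination h
  rcases mul_eq_zero.1 h1 with h2 | h2
  · exact Or.inl (sub_eq_zero.1 h2)
  · right
    have hre := congrArg Complex.re h2
    have him := congrArg Complex.im h2
    simp only [pow_two, Complex.add_re, Complex.add_im, Complex.mul_re, Complex.mul_im,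
      Complex.ofReal_re, Complex.ofReal_im, Complex.zero_re, Complex.zero_im] at hre him
    have h3 : β.im * (2 * β.re + α) = 0 := by linear_combination him
    rcases mul_eq_zero.1 h3 with h4 | h4
    · rw [h4] at hre
      nlinarith [sq_nonneg (2 * β.re + α)]
    · linarith

theorem norm_lt_one_of_re {z : ℂ} {c : ℝ} (hc : 0 < c) (h : c < |((c : ℂ) * z⁻¹).re|) :
    ‖z‖ < 1 := by
  have h1 := h.trans_le (Complex.abs_re_le_norm _)
  rw [norm_mul, Complex.norm_real, Real.norm_of_nonneg hc.le, norm_inv] at h1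
  have h2 : 1 < ‖z‖⁻¹ := by nlinarith
  by_contra hz
  exact absurd h2 (not_lt.2 (inv_le_one_of_one_le₀ (not_lt.1 hz)))

theorem cube_rpow_one_third {x : ℝ} (hx : 0 ≤ x) : (x ^ (1 / 3 : ℝ)) ^ 3 = x := by
  rw [← Real.rpow_natCast, ← Real.rpow_mul hx]
  norm_num

/-! ### The concrete rings -/

theorem exists_base_adic {b : ℕ} (hb : 2 ≤ b) : ∃ u : ℝ, 1 < u ∧ LocallyFiniteDigitSums u ∧
    Subring.closure {(b : ℝ)⁻¹} ≤ Subring.closure ({u, u⁻¹} : Set ℝ) :=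
  ⟨b, by exact_mod_cast hb, locallyFiniteDigitSums_natCast b, Subring.closure_mono (by simp)⟩

theorem exists_base_sqrtTwo : ∃ u : ℝ, 1 < u ∧ LocallyFiniteDigitSums u ∧
    Subring.closure {(2 : ℝ)⁻¹, Real.sqrt 2} ≤ Subring.closure ({u, u⁻¹} : Set ℝ) := by
  have hsq : Real.sqrt 2 * Real.sqrt 2 = 2 := Real.mul_self_sqrt (by norm_num)
  have h0 := Real.sqrt_nonneg 2
  set r := Real.sqrt 2
  have h1 : 1 < r := by nlinarith
  have h2 : r < 2 := by nlinarith
  refine ⟨2 + r, by linarith, locallyFiniteDigitSums_quadratic (u' := 2 - r) 4 2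
    (by push_cast; ring) (by push_cast; linear_combination -hsq)
    (abs_lt.2 ⟨by linarith, by linarith⟩), ?_⟩
  have hu : (2 + r) ∈ Subring.closure ({2 + r, (2 + r)⁻¹} : Set ℝ) :=
    Subring.subset_closure (by simp)
  have hi : (2 + r)⁻¹ ∈ Subring.closure ({2 + r, (2 + r)⁻¹} : Set ℝ) :=
    Subring.subset_closure (by simp)
  have hne : 2 + r ≠ 0 := by linarith
  rw [Subring.closure_le]
  rintro x (rfl | rfl)
  -- Here `1 - 1 / u = √2 / 2`, whose square is `1 / 2`.
  · convert! Subring.pow_mem _ (Subring.sub_mem _ (Subring.one_mem _) hi) 2 using 1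
    field_simp
    linear_combination -hsq
  · convert! Subring.sub_mem _ hu (natCast_mem _ 2) using 1
    push_cast
    ring

theorem exists_base_sqrtSqSubOne {b : ℕ} (hb : 2 ≤ b) : ∃ u : ℝ, 1 < u ∧
    LocallyFiniteDigitSums u ∧ Subring.closure {(b : ℝ)⁻¹, Real.sqrt ((b : ℝ) ^ 2 - 1)} ≤
      Subring.closure ({u, u⁻¹} : Set ℝ) := by
  have hb' : (2 : ℝ) ≤ b := by exact_mod_cast hb
  have hsq := Real.mul_self_sqrt (show (0 : ℝ) ≤ (b : ℝ) ^ 2 - 1 by nlinarith)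
  have h0 := Real.sqrt_nonneg ((b : ℝ) ^ 2 - 1)
  set r := Real.sqrt ((b : ℝ) ^ 2 - 1)
  have h1 : 0 < r := by nlinarith
  have h2 : r < b := by nlinarith
  have hu1 : 1 < (b : ℝ) ^ 2 + b * r := by nlinarith
  refine ⟨(b : ℝ) ^ 2 + b * r, hu1, locallyFiniteDigitSums_quadratic (u' := (b : ℝ) ^ 2 - b * r)
    (2 * b ^ 2) (b ^ 2) (by push_cast; ring) (by push_cast; linear_combination (-(b : ℝ) ^ 2) * hsq)
    (abs_lt.2 ⟨by nlinarith, by nlinarith⟩), ?_⟩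
  set u := (b : ℝ) ^ 2 + b * r with hu_def
  have hu : u ∈ Subring.closure ({u, u⁻¹} : Set ℝ) := Subring.subset_closure (by simp)
  have hi : u⁻¹ ∈ Subring.closure ({u, u⁻¹} : Set ℝ) := Subring.subset_closure (by simp)
  have hne : u ≠ 0 := by linarith
  have hb0 : (b : ℝ) ≠ 0 := by linarith
  have hquad : u ^ 2 = 2 * b ^ 2 * u - b ^ 2 := by
    rw [hu_def]; linear_combination (b : ℝ) ^ 2 * hsq
  have hbi : (b : ℝ)⁻¹ ∈ Subring.closure ({u, u⁻¹} : Set ℝ) := by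
    -- Dividing `u² = 2b²u - b²` by `b * u²` gives `1 / b = b * u⁻¹ * (2 - u⁻¹)`.
    convert! Subring.mul_mem _ (natCast_mem _ b)
      (Subring.mul_mem _ hi (Subring.sub_mem _ (natCast_mem _ 2) hi)) using 1
    push_cast
    field_simp
    linear_combination hquad
  rw [Subring.closure_le]
  rintro x (rfl | rfl)
  · exact hbi
  · convert! Subring.mul_mem _ hbi (Subring.sub_mem _ hu
      (Subring.pow_mem _ (natCast_mem _ b) 2)) using 1
    rw [hu_def]
    field_simp
    ring

theorem exists_base_cbrtSeven : ∃ u : ℝ, 1 < u ∧ LocallyFiniteDigitSums u ∧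
    Subring.closure {(7 : ℝ) ^ (1 / 3 : ℝ)} ≤ Subring.closure ({u, u⁻¹} : Set ℝ) := by
  have hcube := cube_rpow_one_third (show (0 : ℝ) ≤ 7 by norm_num)
  have hpos : 0 < (7 : ℝ) ^ (1 / 3 : ℝ) := by positivity
  set α := (7 : ℝ) ^ (1 / 3 : ℝ)
  have hu1 : 1 < 4 + 2 * α + α ^ 2 := by nlinarith
  -- The base is the inverse of the small unit `2 - ∛7`, as `8 - 7 = 1`. A conjugate `z ≠ u` has `Re
  -- (1 / z) = 2 + α / 2 > 1`.
  have hinv : (4 + 2 * α + α ^ 2)⁻¹ = 2 - α :=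
    inv_eq_of_mul_eq_one_right (by linear_combination -hcube)
  refine ⟨4 + 2 * α + α ^ 2, hu1, locallyFiniteDigitSums_of_roots
    (Polynomial.X ^ 3 - 12 * Polynomial.X ^ 2 + 6 * Polynomial.X - 1) (by monicity!) ?_
    fun z hz => ?_, ?_⟩
  · simp only [map_add, map_sub, map_mul, map_pow, Polynomial.aeval_X, map_one, map_ofNat]
    linear_combination (α ^ 3 + 6 * α ^ 2 + 12 * α + 15) * hcube
  · simp only [map_add, map_sub, map_mul, map_pow, Polynomial.aeval_X, map_one, map_ofNat] at hz
    have hz0 : z ≠ 0 := by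
      rintro rfl
      norm_num at hz
    have hβ : (2 - z⁻¹) ^ 3 = (α : ℂ) ^ 3 := by
      have : (α : ℂ) ^ 3 = 7 := by exact_mod_cast congrArg ((↑) : ℝ → ℂ) hcube
      rw [this]
      field_simp
      linear_combination hz
    rcases eq_or_re_eq_of_cube_eq hpos hβ with h | h
    · left
      rw [← inv_inj, ← Complex.ofReal_inv, hinv]
      push_cast
      linear_combination -h
    · right
      refine norm_lt_one_of_re one_pos ?_
      rw [Complex.sub_re] at h
      have h2 : (2 : ℂ).re = 2 := rfl
      rw [Complex.ofReal_one, one_mul, lt_abs]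
      left
      linarith
  · rw [Subring.closure_le, Set.singleton_subset_iff]
    have hi := Subring.subset_closure (s := {4 + 2 * α + α ^ 2, (4 + 2 * α + α ^ 2)⁻¹})
      (Set.mem_insert_of_mem _ rfl)
    convert! Subring.sub_mem _ (natCast_mem _ 2) hi using 1
    rw [hinv]
    push_cast
    ring

theorem exists_base_cbrtSixtyFive : ∃ u : ℝ, 1 < u ∧ LocallyFiniteDigitSums u ∧
    Subring.closure {(2 : ℝ)⁻¹, (65 : ℝ) ^ (1 / 3 : ℝ)} ≤
      Subring.closure ({u, u⁻¹} : Set ℝ) := by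
  have hcube := cube_rpow_one_third (show (0 : ℝ) ≤ 65 by norm_num)
  have hpos : 0 < (65 : ℝ) ^ (1 / 3 : ℝ) := by positivity
  set α := (65 : ℝ) ^ (1 / 3 : ℝ)
  have hu1 : 1 < 2 * (16 + 4 * α + α ^ 2) := by nlinarith
  -- From `65 - 64 = 1`. The extra factor `2` in the base makes `2` invertible: with `y = 1 / u`,
  -- expanding `(4 + 2y)³ = 65` gives `1 / 2 = 48y + 24y² + 4y³`.
  have hinv : (2 * (16 + 4 * α + α ^ 2))⁻¹ = (α - 4) / 2 :=
    inv_eq_of_mul_eq_one_right (by linear_combination hcube)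
  refine ⟨2 * (16 + 4 * α + α ^ 2), hu1, locallyFiniteDigitSums_of_roots
    (Polynomial.X ^ 3 - 96 * Polynomial.X ^ 2 - 48 * Polynomial.X - 8) (by monicity!) ?_
    fun z hz => ?_, ?_⟩
  · simp only [map_sub, map_mul, map_pow, Polynomial.aeval_X, map_ofNat]
    linear_combination (8 * α ^ 3 + 96 * α ^ 2 + 384 * α + 1032) * hcube
  · simp only [map_sub, map_mul, map_pow, Polynomial.aeval_X, map_ofNat] at hz
    have hz0 : z ≠ 0 := by
      rintro rfl
      norm_num at hz
    have hβ : (4 + 2 * z⁻¹) ^ 3 = (α : ℂ) ^ 3 := by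
      have : (α : ℂ) ^ 3 = 65 := by exact_mod_cast congrArg ((↑) : ℝ → ℂ) hcube
      rw [this]
      field_simp
      linear_combination -hz
    rcases eq_or_re_eq_of_cube_eq hpos hβ with h | h
    · left
      rw [← inv_inj, ← Complex.ofReal_inv, hinv]
      push_cast
      linear_combination h / 2
    · right
      refine norm_lt_one_of_re two_pos ?_
      rw [Complex.add_re] at h
      have h4 : (4 : ℂ).re = 4 := rfl
      rw [Complex.ofReal_ofNat, lt_abs]
      right
      linarith
  · have hi := Subring.subset_closure
      (s := {2 * (16 + 4 * α + α ^ 2), (2 * (16 + 4 * α + α ^ 2))⁻¹}) (Set.mem_insert_of_mem _ rfl)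
    have hα : α = (4 : ℕ) + (2 : ℕ) * (2 * (16 + 4 * α + α ^ 2))⁻¹ := by
      rw [hinv]
      push_cast
      ring
    have hhalf : (2 : ℝ)⁻¹ = (48 : ℕ) * (2 * (16 + 4 * α + α ^ 2))⁻¹ +
        (24 : ℕ) * (2 * (16 + 4 * α + α ^ 2))⁻¹ ^ 2 +
        (4 : ℕ) * (2 * (16 + 4 * α + α ^ 2))⁻¹ ^ 3 := by
      rw [hinv]
      push_cast
      linear_combination (-1 / 2 : ℝ) * hcube
    rw [Subring.closure_le]
    rintro x (rfl | hx)
    · rw [hhalf]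
      exact add_mem (add_mem (mul_mem (natCast_mem _ _) hi)
        (mul_mem (natCast_mem _ _) (pow_mem hi 2))) (mul_mem (natCast_mem _ _) (pow_mem hi 3))
    · rw [Set.mem_singleton_iff.1 hx]
      have := add_mem (natCast_mem _ 4) (mul_mem (natCast_mem _ 2) hi)
      rwa [← hα] at this

theorem ConstructedGrid.exists_base {G : Subring ℝ} (hG : ConstructedGrid G) : ∃ u : ℝ, 1 < u ∧
    LocallyFiniteDigitSums u ∧ G ≤ Subring.closure ({u, u⁻¹} : Set ℝ) := by
  cases hG with
  | general D G hG =>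
    refine ⟨D.u, D.one_lt_u, D.locallyFiniteDigitSums, fun x hx => D.values_subset_closure ?_⟩
    rw [← hG]
    exact hx
  | adic b hb => exact exists_base_adic hb
  | sqrtTwo => exact exists_base_sqrtTwo
  | sqrtSqSubOne b hb => exact exists_base_sqrtSqSubOne hb
  | cbrtSeven => exact exists_base_cbrtSeven
  | cbrtSixtyFive => exact exists_base_cbrtSixtyFive

theorem mainTheorem9 (G : Subring ℝ) (hG : ConstructedGrid G) :
    ∃ ρ : RealOmegaRepresentation,
      ρ.AutomaticFun (fun v : Fin 2 → ℝ => v 0 + v 1) ∧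
      ρ.AutomaticFun (fun v : Fin 2 → ℝ => v 0 - v 1) ∧
      ρ.AutomaticRel (fun v : Fin 2 → ℝ => v 0 = v 1) ∧
      ρ.AutomaticRel (fun v : Fin 2 → ℝ => v 0 < v 1) ∧
      ρ.AutomaticRel (fun v : Fin 2 → ℝ => v 0 ≤ v 1) ∧
      ∀ g ∈ G, ρ.AutomaticFun (fun v : Fin 1 → ℝ => g * v 0) := by
  obtain ⟨u, hu, hfin, hGu⟩ := hG.exists_base
  exact exists_representation hu hfin G hGu
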